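/- **Theorem 3.4.** Let $X$ be a Tychonoff (completely regular $T_1$) cut-point space, i.e. $X$ is connected and $X\setminus\{x\}$ is disconnected for every $x\in X$. Suppose that the Stone–Čech compactification $\beta X$ is an irreducible continuum; that is, $\beta X$ is a connected compact Hausdorff space and there are two points $p,q\in\beta X$ such that no proper subcontinuum (compact connected subset) of $\beta X$ contains both $p$ and $q$. Then $X$ is weakly ordered (weakly orderable): there is a continuous one-to-one mapping of $X$ into a Hausdorff arc, i.e. into a connected compact Hausdorff space whose topology is the order topology of some linear order. -/

import Mathlib

universe u

/-- `x` is a cut point of `X`: the complement of `x` is disconnected, i.e. it is the union of two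
disjoint nonempty relatively open sets. (The empty set counts as not disconnected.) -/
def IsCutPoint {X : Type u} [TopologicalSpace X] (x : X) : Prop :=
  ¬ IsPreconnected ({x}ᶜ : Set X)

/-- A cut-point space: a connected space in which every point is a cut point. -/
structure IsCutPointSpace (X : Type u) [TopologicalSpace X] : Prop where
  connected : ConnectedSpace X
  cutPoint : ∀ x : X, IsCutPoint x

/-- A continuum: a connected compact Hausdorff space. -/
structure IsContinuum (X : Type u) [TopologicalSpace X] : Prop where
  compact : CompactSpace X
  t2 : T2Space X
  connected : ConnectedSpace X

/-- `K` is a subcontinuum of `X`: with the subspace topology it is a continuum. -/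
def IsSubcontinuum {X : Type u} [TopologicalSpace X] (K : Set X) : Prop :=
  IsContinuum K

/-- `X` is irreducible between `a` and `b`: no proper subcontinuum of `X` contains both. -/
def IsIrreducibleBetween (X : Type u) [TopologicalSpace X] (a b : X) : Prop :=
  ∀ K : Set X, IsSubcontinuum K → a ∈ K → b ∈ K → K = Set.univ

/-- An irreducible continuum: a continuum irreducible between some two of its points. -/
structure IsIrreducibleContinuum (X : Type u) [TopologicalSpace X] : Prop where
  continuum : IsContinuum X
  irreducible : ∃ a b : X, a ≠ b ∧ IsIrreducibleBetween X a b

/-- A Hausdorff arc: a continuum whose topology is the order topology of the given linear order. -/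
structure IsHausdorffArc (Y : Type u) [TopologicalSpace Y] [LinearOrder Y] : Prop where
  continuum : IsContinuum Y
  orderTopology : OrderTopology Y

/-- `X` is weakly orderable (weakly ordered): there is a continuous one-to-one map of `X` into a
Hausdorff arc. -/
def IsWeaklyOrderable (X : Type u) [TopologicalSpace X] : Prop :=
  ∃ (Y : Type u) (_ : TopologicalSpace Y) (_ : LinearOrder Y),
    IsHausdorffArc Y ∧ ∃ f : X → Y, Continuous f ∧ Function.Injective f

/-! Adding `x` to either side of a separation of its complement gives a proper closed connected
subset of `X`. By irreducibility its closure in `βX` cannot contain both `p` and `q`; the two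
closures cover `βX`, so one side `A x` belongs to `p` and the other, `B x`, to `q`. Put `y < x` when
`y ∈ A x`. Connectedness makes the sides of different points nested, so this is a linear order with
open rays, and an order completion of `X` is the arc. -/

open Set in
/-- A space carrying a linear order whose open rays are open is weakly orderable. -/
theorem isWeaklyOrderable_of_isOpen_rays {X : Type u} [t : TopologicalSpace X] [LinearOrder X]
    (hIio : ∀ x : X, IsOpen (Iio x)) (hIoi : ∀ x : X, IsOpen (Ioi x)) :
    IsWeaklyOrderable X := by
  -- The completion is formed for the order topology. The given topology is finer because rays are
  -- open, so `ι` stays continuous.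
  obtain ⟨Y, _, _, _, _, ι, hι⟩ :=
    @Order.exists_dense_continuous_completion X _ (Preorder.topology X)
      (@OrderTopology.mk X (Preorder.topology X) _ rfl)
  refine ⟨Y, inferInstance, inferInstance, ⟨⟨inferInstance, inferInstance, ?_⟩, inferInstance⟩,
    ι, continuous_le_dom ?_ hι, ι.injective⟩
  · exact ⟨⟨⊥⟩⟩
  · refine le_generateFrom ?_
    rintro s ⟨a, rfl | rfl⟩
    exacts [hIoi a, hIio a]

open Set in
/-- In a connected space, each side of a separation of the complement of a point `x` becomes
connected once `x` is added. -/
theorem isPreconnected_insert_of_separation {X : Type u} [TopologicalSpace X] [PreconnectedSpace X]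
    {x : X} {A B : Set X} (hA : IsOpen A) (hB : IsOpen B) (hAB : Disjoint A B)
    (hU : A ∪ B = {x}ᶜ) : IsPreconnected (insert x A) := by
  have key : ∀ u v : Set X, IsOpen u → IsOpen v → insert x A ⊆ u ∪ v → x ∈ u →
      (insert x A ∩ v).Nonempty → (insert x A ∩ (u ∩ v)).Nonempty := by
    intro u v hu hv huv hxu hne
    by_contra hempty
    rw [not_nonempty_iff_eq_empty] at hempty
    have hxA : x ∉ A := fun h => (hU ▸ Or.inl h : x ∈ ({x}ᶜ : Set X)) rfl
    -- If `u` and `v` separated `insert x A`, the part `A ∩ v` would be clopen in all of `X`.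
    have hcompl : (A ∩ v)ᶜ = B ∪ u := by
      ext y
      have h1 : y ∈ A → y ∉ B := fun h h' => hAB.le_bot ⟨h, h'⟩
      have h2 : y ∈ A ∪ B ↔ y ∈ ({x}ᶜ : Set X) := by rw [hU]
      have h3 : y ∉ insert x A ∩ (u ∩ v) := by simp [hempty]
      have h4 := @huv y
      simp only [mem_union, mem_compl_iff, mem_singleton_iff, mem_inter_iff, mem_insert_iff]
        at h2 h3 h4 ⊢
      by_cases hy : y = x
      · subst hy; tauto
      · tauto
    have hclopen : IsClopen (A ∩ v) :=
      ⟨⟨hcompl ▸ hB.union hu⟩, hA.inter hv⟩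
    rcases isClopen_iff.1 hclopen with h | h
    · obtain ⟨y, rfl | hyA, hyv⟩ := hne
      · exact hempty.le ⟨mem_insert _ _, hxu, hyv⟩
      · exact h.le ⟨hyA, hyv⟩
    · exact hxA (h.ge (mem_univ x)).1
  intro u v hu hv huv hneu hnev
  rcases huv (mem_insert x A) with hx | hx
  · exact key u v hu hv huv hx hnev
  · rw [inter_comm u v]
    exact key v u hv hu (union_comm u v ▸ huv) hx hneu

open Set in
/-- If `K` is an irreducible continuum between `p` and `q` and `X` is embedded in `K`, then the
closure in `K` of a proper closed connected subset of `X` does not contain both `p` and `q`. -/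
theorem IsIrreducibleBetween.not_mem_closure_image {X K : Type u} [TopologicalSpace X]
    [TopologicalSpace K] [CompactSpace K] [T2Space K] {p q : K} (h : IsIrreducibleBetween K p q)
    {e : X → K} (he : Topology.IsEmbedding e) {C : Set X} (hC : IsClosed C) (hne : C ≠ univ)
    (hconn : IsPreconnected C) (hp : p ∈ closure (e '' C)) : q ∉ closure (e '' C) := by
  intro hq
  have huniv : closure (e '' C) = univ := by
    refine h _ ⟨isCompact_iff_compactSpace.1 isClosed_closure.isCompact, inferInstance, ?_⟩ hp hq
    exact isConnected_iff_connectedSpace.1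
      ⟨⟨p, hp⟩, (hconn.image e he.continuous.continuousOn).closure⟩
  refine hne ?_
  -- A closed set is the trace on `X` of its closure in `K`.
  rw [← hC.closure_eq, he.closure_eq_preimage_closure_image, huniv, preimage_univ]

open Set in
/-- In a cut-point space embedded densely in a continuum irreducible between `p` and `q`, the
complement of each point splits into an open side near `p` and an open side near `q`. -/
theorem exists_sides {X K : Type u} [TopologicalSpace X] [T1Space X] [PreconnectedSpace X]
    [TopologicalSpace K] [CompactSpace K] [T2Space K] {p q : K} (h : IsIrreducibleBetween K p q)
    {e : X → K} (he : IsDenseEmbedding e) {x : X} (hx : IsCutPoint x) :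
    ∃ A B : Set X, IsOpen A ∧ IsOpen B ∧ Disjoint A B ∧ A ∪ B = {x}ᶜ ∧
      p ∈ closure (e '' insert x A) ∧ q ∉ closure (e '' insert x A) ∧
      q ∈ closure (e '' insert x B) ∧ p ∉ closure (e '' insert x B) := by
  simp only [IsCutPoint, IsPreconnected, not_forall] at hx
  obtain ⟨u, v, hu, hv, huv, ⟨a, hax, hau⟩, ⟨b, hbx, hbv⟩, hempty⟩ := hx
  rw [not_nonempty_iff_eq_empty] at hempty
  have hxo : IsOpen ({x}ᶜ : Set X) := isOpen_compl_singleton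
  have hA : IsOpen ({x}ᶜ ∩ u) := hxo.inter hu
  have hB : IsOpen ({x}ᶜ ∩ v) := hxo.inter hv
  have hAB : Disjoint ({x}ᶜ ∩ u) ({x}ᶜ ∩ v) := by
    rw [disjoint_iff_inter_eq_empty, ← inter_inter_distrib_left, hempty]
  have hU : ({x}ᶜ ∩ u) ∪ ({x}ᶜ ∩ v) = {x}ᶜ := by
    rw [← inter_union_distrib_left, inter_eq_left.2 huv]
  have ha : a ∈ {x}ᶜ ∩ u := ⟨hax, hau⟩
  have hb : b ∈ {x}ᶜ ∩ v := ⟨hbx, hbv⟩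
  generalize ({x}ᶜ ∩ u) = A at *
  generalize ({x}ᶜ ∩ v) = B at *
  have side : ∀ C D : Set X, IsOpen C → IsOpen D → Disjoint C D → C ∪ D = {x}ᶜ →
      D.Nonempty → IsClosed (insert x C) ∧ insert x C ≠ univ ∧ IsPreconnected (insert x C) := by
    intro C D hC hD hCD hCDx ⟨d, hd⟩
    have hcompl : (insert x C)ᶜ = D := by
      ext y
      have h1 : y ∈ C → y ∉ D := fun h h' => hCD.le_bot ⟨h, h'⟩
      have h2 : y ∈ C ∪ D ↔ y ∈ ({x}ᶜ : Set X) := by rw [hCDx]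
      simp only [mem_union, mem_compl_iff, mem_singleton_iff, mem_insert_iff] at h2 ⊢
      tauto
    refine ⟨⟨hcompl ▸ hD⟩, fun huniv => ?_, isPreconnected_insert_of_separation hC hD hCD hCDx⟩
    rw [huniv, compl_univ] at hcompl
    exact hcompl.ge hd
  obtain ⟨hAc, hAne, hAconn⟩ := side A B hA hB hAB hU ⟨b, hb⟩
  obtain ⟨hBc, hBne, hBconn⟩ := side B A hB hA hAB.symm (union_comm A B ▸ hU) ⟨a, ha⟩
  have hcover : ∀ z : K, z ∈ closure (e '' insert x A) ∨ z ∈ closure (e '' insert x B) := by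
    intro z
    have hAB' : insert x A ∪ insert x B = univ := by
      rw [← insert_union_distrib, hU, insert_eq, union_compl_self]
    have hz : z ∈ closure (range e) := he.dense z
    rwa [← image_univ, ← hAB', image_union, closure_union] at hz
  have nA := h.not_mem_closure_image he.isEmbedding hAc hAne hAconn
  have nB := h.not_mem_closure_image he.isEmbedding hBc hBne hBconn
  -- Each of `p`, `q` lies in some closure and no closure holds both, so only the naming of the
  -- sides remains.
  rcases hcover p with hpA | hpB
  · have hqB := (hcover q).resolve_left (nA hpA)
    exact ⟨A, B, hA, hB, hAB, hU, hpA, nA hpA, hqB, fun hp => nB hp hqB⟩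
  · have hqA := (hcover q).resolve_right (nB hpB)
    exact ⟨B, A, hB, hA, hAB.symm, union_comm A B ▸ hU, hpB, nB hpB, hqA, fun hp => nA hp hqA⟩

open Set in
/-- A `T₁` cut-point space embedded densely in a continuum irreducible between two of its points is
weakly orderable: `x < y` when `x` lies on the first side of `y`. -/
theorem IsCutPointSpace.isWeaklyOrderable_of_isDenseEmbedding {X K : Type u} [TopologicalSpace X]
    [T1Space X] (hX : IsCutPointSpace X) [TopologicalSpace K] [CompactSpace K] [T2Space K]
    {p q : K} (h : IsIrreducibleBetween K p q) {e : X → K} (he : IsDenseEmbedding e) :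
    IsWeaklyOrderable X := by
  have := hX.connected
  choose A B hA hB hAB hU hpA hqA hqB hpB using fun x => exists_sides h he (hX.cutPoint x)
  have hne : ∀ {x y}, y ∈ A x ∪ B x ↔ y ≠ x := fun {x y} => by rw [hU x]; rfl
  have hAne : ∀ {x y}, y ∈ A x → y ≠ x := fun hy => hne.1 (Or.inl hy)
  have hBne : ∀ {x y}, y ∈ B x → y ≠ x := fun hy => hne.1 (Or.inr hy)
  have insB : ∀ {x y}, y ∈ A x → insert x (B x) ⊆ B y := by
    intro x y hy
    have hcov : insert x (B x) ⊆ A y ∪ B y := by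
      rintro z (rfl | hz)
      · exact hne.2 (hAne hy).symm
      · exact hne.2 fun hzy => (hAB x).le_bot ⟨hy, hzy ▸ hz⟩
    -- This connected set misses `y`, so it lies on one side of `y`; its closure contains `q`, which
    -- rules out `A y`.
    refine ((isPreconnected_insert_of_separation (hB x) (hA x) (hAB x).symm
      (union_comm (A x) (B x) ▸ hU x)).subset_or_subset (hA y) (hB y) (hAB y) hcov).resolve_left
      fun hsub => hqA y ?_
    exact closure_mono (image_mono (hsub.trans (subset_insert _ _))) (hqB x)
  have insA : ∀ {x y}, y ∈ B x → insert x (A x) ⊆ A y := by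
    intro x y hy
    have hcov : insert x (A x) ⊆ A y ∪ B y := by
      rintro z (rfl | hz)
      · exact hne.2 (hBne hy).symm
      · exact hne.2 fun hzy => (hAB x).le_bot ⟨hzy ▸ hz, hy⟩
    refine ((isPreconnected_insert_of_separation (hA x) (hB x) (hAB x)
      (hU x)).subset_or_subset (hA y) (hB y) (hAB y) hcov).resolve_right
      fun hsub => hpB y ?_
    exact closure_mono (image_mono (hsub.trans (subset_insert _ _))) (hpA x)
  have hmem : ∀ {x y}, y ∈ A x ↔ x ∈ B y :=
    ⟨fun hy => insB hy (mem_insert _ _), fun hy => insA hy (mem_insert _ _)⟩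
  have hstrict : IsStrictTotalOrder X fun x y => x ∈ A y :=
    { irrefl := fun x hx => hAne hx rfl
      trans := fun x y z hxy hyz => insA (hmem.1 hyz) (Or.inr hxy)
      trichotomous := fun x y hxy hyx => by
        by_contra hne'
        exact (hne.2 hne').elim hxy fun hx => hyx (hmem.2 hx) }
  classical
  let : LinearOrder X := linearOrderOfSTO fun x y => x ∈ A y
  refine isWeaklyOrderable_of_isOpen_rays (fun x => hA x) fun x => ?_
  -- The duality `hmem` turns upper rays into the open sides at `q`.
  have hIoi : Ioi x = B x := Set.ext fun y => hmem
  exact hIoi ▸ hB x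

theorem theorem3p4 (X : Type u) [TopologicalSpace X] [T35Space X]
    (hX : IsCutPointSpace X) (hβX : IsIrreducibleContinuum (StoneCech X)) :
    IsWeaklyOrderable X := by
  obtain ⟨p, q, -, h⟩ := hβX.irreducible
  exact hX.isWeaklyOrderable_of_isDenseEmbedding h isDenseEmbedding_stoneCechUnit
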